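/- Let $G=(V,(c_{xy})_{x,y\in V})$ be a finite weighted graph with $|V|\ge 2$, symmetric conductances $c_{xy}=c_{yx}\ge 0$, $c_{xx}=0$, and assume that the graph with edge set $\{xy: c_{xy}>0\}$ is connected; let $\mathrm{diam}(G)$ be its diameter in the graph distance. Let $\alpha=(\alpha_x)_{x\in V}$ be positive site weights, $|\alpha|=\sum_{x}\alpha_x$, and set $$\alpha_{\min}=\min_{x\in V}\alpha_x,\quad \alpha_{\max}=\max_{x\in V}\alpha_x,\quad \alpha_{\rm ratio}=\frac{\alpha_{\min}}{\alpha_{\max}},\quad c_{\min}=\min_{x,y:\,c_{xy}>0}c_{xy}.$$ For $k\in\mathbb N$ let $\Xi_k=\{\eta\in\mathbb N_0^V:\sum_x\eta_x=k\}$ and let $\mu_{\alpha,k}$ be the probability measure $$\mu_{\alpha,k}(\eta)=\frac{1}{Z_{\alpha,k}}\prod_{x\in V}\frac{\Gamma(\alpha_x+\eta_x)}{\Gamma(\alpha_x)\,\eta_x!},\qquad Z_{\alpha,k}=\frac{\Gamma(|\alpha|+k)}{\Gamma(|\alpha|)\,k!},\qquad \eta\in\Xi_k .$$ For $f:\Xi_k\to\mathbb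 R$, the Dirichlet form of the $k$-particle symmetric inclusion process on $G$ is $$\mathcal E_{G,\alpha,k}(f)=\frac12\sum_{\eta\in\Xi_k}\sum_{x,y\in V}\mu_{\alpha,k}(\eta)\,c_{xy}\,\eta_x(\alpha_y+\eta_y)\bigl(f(\eta-\delta_x+\delta_y)-f(\eta)\bigr)^2,$$ where $\eta-\delta_x+\delta_y$ is obtained from $\eta$ by moving one particle from $x$ to $y$ (terms with $\eta_x=0$ vanish). Let $\mathcal E_{K,\alpha,k}$ be the same form for the complete graph $K$ on $V$ with $c_{xy}=1$ for all $x\neq y$. Then, for all $k\ge 2$ and all $f:\Xi_k\to\mathbb R$, $$\mathcal E_{K,\alpha,k}(f)\le \frac{21\,k\,(\alpha_{\max}+k-1)\,|V|^2\,\mathrm{diam}(G)\,6^{\alpha_{\max}}}{\alpha_{\min}\,\alpha_{\rm ratio}\,c_{\min}}\;\mathcal E_{G,\alpha,k}(f).$$ -/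

import Mathlib

namespace SIP

/-- A weighted graph on `V`, given by symmetric non-negative conductances `c`,
with `c x x = 0`. -/
structure WGraph (V : Type*) where
  c : V → V → ℝ
  symm : ∀ x y, c x y = c y x
  nonneg : ∀ x y, 0 ≤ c x y
  self : ∀ x, c x x = 0

/-- The undirected graph whose edges are the pairs with positive conductance. -/
def WGraph.toSimpleGraph {V : Type*} (G : WGraph V) : SimpleGraph V where
  Adj x y := 0 < G.c x y
  symm := ⟨fun x y h => by rw [G.symm y x]; exact h⟩
  loopless := ⟨fun x h => by rw [G.self x] at h; exact lt_irrefl 0 h⟩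

/-- The complete graph on `V` with unit conductances. -/
def completeWGraph (V : Type*) [DecidableEq V] : WGraph V where
  c x y := if x = y then 0 else 1
  symm x y := by simp only [eq_comm]
  nonneg x y := by split_ifs <;> norm_num
  self x := by simp

/-- The smallest positive conductance `c_min`. -/
noncomputable def WGraph.cMin {V : Type*} (G : WGraph V) : ℝ :=
  sInf {r : ℝ | 0 < r ∧ ∃ x y, G.c x y = r}

/-- The smallest site weight. -/
noncomputable def alphaMin {V : Type*} [Fintype V] [Nonempty V] (α : V → ℝ) : ℝ :=
  Finset.univ.inf' Finset.univ_nonempty α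

/-- The largest site weight. -/
noncomputable def alphaMax {V : Type*} [Fintype V] [Nonempty V] (α : V → ℝ) : ℝ :=
  Finset.univ.sup' Finset.univ_nonempty α

/-- The ratio of the smallest to the largest site weight. -/
noncomputable def alphaRatio {V : Type*} [Fintype V] [Nonempty V] (α : V → ℝ) : ℝ :=
  alphaMin α / alphaMax α

/-- The space `Ξ_k` of configurations of `k` indistinguishable particles on `V`. -/
abbrev Config (V : Type*) [Fintype V] (k : ℕ) : Type _ :=
  {η : V → ℕ // ∑ x, η x = k}

instance instFintypeConfig (V : Type*) [Fintype V] [DecidableEq V] (k : ℕ) :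
    Fintype (Config V k) :=
  Fintype.subtype (Finset.piAntidiag Finset.univ k) (by intro η; simp)

theorem sum_move {V : Type*} [Fintype V] [DecidableEq V] {η : V → ℕ} {x : V}
    (y : V) (hx : 0 < η x) :
    ∑ z, (η - Pi.single x 1 + Pi.single y 1 : V → ℕ) z = ∑ z, η z := by
  have h : (η - Pi.single x 1 + Pi.single x 1 : V → ℕ) = η := by
    funext z
    by_cases hz : z = x
    · subst hz
      simp only [Pi.add_apply, Pi.sub_apply, Pi.single_eq_same]
      omega
    · simp [hz]
  have h2 : ∑ z, (η - Pi.single x 1 + Pi.single x 1 : V → ℕ) z = ∑ z, η z := by rw [h]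
  simp only [Pi.add_apply, Finset.sum_add_distrib, Finset.mem_univ,
    if_true, Pi.single_apply, Finset.sum_ite_eq'] at h2 ⊢
  exact h2

/-- The configuration `η - δ_x + δ_y`: a particle, if there is one at `x`, moves from `x`
to `y`; if `x` is empty, nothing happens. -/
def Config.move {V : Type*} [Fintype V] [DecidableEq V] {k : ℕ}
    (η : Config V k) (x y : V) : Config V k :=
  if hx : 0 < η.1 x then
    ⟨η.1 - Pi.single x 1 + Pi.single y 1, (sum_move y hx).trans η.2⟩
  else η

/-- The normalizing constant `Z_{α,k} = Γ(|α| + k) / (Γ(|α|) k!)`. -/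
noncomputable def partitionFn {V : Type*} [Fintype V] (α : V → ℝ) (k : ℕ) : ℝ :=
  Real.Gamma ((∑ x, α x) + k) / (Real.Gamma (∑ x, α x) * (k.factorial : ℝ))

/-- The reversible (Dirichlet-multinomial) measure `μ_{α,k}` on `Ξ_k`. -/
noncomputable def mu {V : Type*} [Fintype V] (α : V → ℝ) {k : ℕ} (η : Config V k) : ℝ :=
  1 / partitionFn α k *
    ∏ x, Real.Gamma (α x + η.1 x) / (Real.Gamma (α x) * ((η.1 x).factorial : ℝ))

/-- The Dirichlet form `𝓔_{G,α,k}(f)` of the `k`-particle symmetric inclusion process, in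
which a particle jumps from `x` to `y` at rate `c_{xy} (α_y + η_y)`. -/
noncomputable def dirichletForm {V : Type*} [Fintype V] [DecidableEq V]
    (G : WGraph V) (α : V → ℝ) (k : ℕ) (f : Config V k → ℝ) : ℝ :=
  1 / 2 * ∑ η : Config V k, ∑ x, ∑ y,
    mu α η * G.c x y * (η.1 x : ℝ) * (α y + (η.1 y : ℝ)) * (f (η.move x y) - f η) ^ 2

end SIP

/-! Conditioning on the configuration `ξ` of the `k - 1` particles that do not jump turns the form
into a sum over `ξ` and pairs of `c x y * pairEnergy` (`dirichletForm_eq`), so single-pair energies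
on the complete graph must be bounded by energies of edges of `G`.

If `x` or `y` is empty in `ξ`, then `(α x + ξ x) * (α y + ξ y)` is at most linear in the occupation
numbers. It suffices to carry the particle along a geodesic with `ξ` frozen, since each edge has
rate factors at least `α_min ^ 2` (`cMin_mul_weight_mul_sq_le`).

If both are occupied, freezing `ξ` would cost about `k ^ 2 / α_min ^ 2`, which lacks the factor
`α_max` that matters for small weights. Geodesics are therefore cut at occupied sites
(`sq_sub_le_dist_mul_sum`), leaving pairs `u`, `v` whose connecting geodesic has empty interior. For
such a pair with `n` particles at `u`, one leaves `j` particles at `u`, carries the other `n + 1 -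
j` next to `v`, drops one there and carries the rest back. The key identity is that the site weights
of `0, ..., n` sum to `(α u + n) / α u` times the weight of `n`. Averaging over `j` with these
weights thus gains a factor `α u / (α u + n)`, which pays for the size of the pile
(`weight_mul_sq_le`). Intermediate configurations determine `ξ` and `j`, so summing over `ξ` creates
no multiplicity (`cMin_mul_sum_good_le`). -/

namespace SIP

/-! ### Site weights and the form as a sum over background configurations. -/

section Weights

/-- The single-site weight `Γ(a + m) / (Γ(a) m!)`. -/
noncomputable def siteWeight (a : ℝ) (m : ℕ) : ℝ :=
  Real.Gamma (a + m) / (Real.Gamma a * (m.factorial : ℝ))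

theorem siteWeight_zero {a : ℝ} (ha : 0 < a) : siteWeight a 0 = 1 := by
  have := (Real.Gamma_pos_of_pos ha).ne'
  simp [siteWeight, this]

theorem siteWeight_pos {a : ℝ} (ha : 0 < a) (m : ℕ) : 0 < siteWeight a m := by
  have h1 := Real.Gamma_pos_of_pos ha
  have h2 : 0 < Real.Gamma (a + m) := Real.Gamma_pos_of_pos (by positivity)
  unfold siteWeight
  positivity

theorem siteWeight_succ {a : ℝ} (ha : 0 < a) (m : ℕ) :
    siteWeight a (m + 1) * (m + 1) = siteWeight a m * (a + m) := by
  have h1 := Real.Gamma_pos_of_pos ha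
  have h2 : Real.Gamma (a + (m + 1 : ℕ)) = (a + m) * Real.Gamma (a + m) := by
    rw [← Real.Gamma_add_one (by positivity)]
    push_cast
    ring_nf
  have h3 : (m.factorial : ℝ) ≠ 0 := by positivity
  have h4 : (m + 1 : ℝ) ≠ 0 := by positivity
  rw [siteWeight, siteWeight, h2, Nat.factorial_succ]
  push_cast
  field_simp

/-- The recursion `siteWeight_succ` makes the partial sums telescope. This is the source of the gain
from averaging over the part of a pile left behind. -/
theorem sum_siteWeight {a : ℝ} (ha : 0 < a) (n : ℕ) :
    a * ∑ j ∈ Finset.range (n + 1), siteWeight a j = siteWeight a n * (a + n) := by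
  induction n with
  | zero => simp [siteWeight_zero ha]
  | succ n ih =>
    rw [Finset.sum_range_succ, mul_add, ih, ← siteWeight_succ ha]
    push_cast
    ring

/-- The term `j = 0` of the preceding sum is already `1`. The bound is uniform in `n`: each site of
a jump contributes at least `a`, whatever the heights of the piles. -/
theorem le_siteWeight_mul {a : ℝ} (ha : 0 < a) (n : ℕ) : a ≤ siteWeight a n * (a + n) := by
  rw [← sum_siteWeight ha, Finset.sum_range_succ', siteWeight_zero ha]
  have : 0 ≤ ∑ j ∈ Finset.range n, siteWeight a (j + 1) :=
    Finset.sum_nonneg fun j _ => (siteWeight_pos ha _).le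
  nlinarith

variable {V : Type*} [Fintype V]

/-- The unnormalized weight of a configuration. -/
noncomputable def weight (α : V → ℝ) (η : V → ℕ) : ℝ := ∏ x, siteWeight (α x) (η x)

theorem weight_pos {α : V → ℝ} (hα : ∀ x, 0 < α x) (η : V → ℕ) : 0 < weight α η :=
  Finset.prod_pos fun x _ => siteWeight_pos (hα x) _

/-- A function on `Ξ_k` extended by zero. -/
noncomputable def extend {k : ℕ} (f : Config V k → ℝ) (η : V → ℕ) : ℝ :=
  if h : ∑ x, η x = k then f ⟨η, h⟩ else 0

theorem extend_coe {k : ℕ} (f : Config V k → ℝ) (η : Config V k) : extend f η.1 = f η := by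
  simp [extend, η.2]

variable [DecidableEq V]

theorem weight_mul_siteWeight {α : V → ℝ} {η ζ : V → ℕ} (x : V) (h : ∀ y, y ≠ x → η y = ζ y) :
    weight α η * siteWeight (α x) (ζ x) = weight α ζ * siteWeight (α x) (η x) := by
  unfold weight
  rw [← Finset.mul_prod_erase _ _ (Finset.mem_univ x),
    ← Finset.mul_prod_erase Finset.univ (fun y => siteWeight (α y) (ζ y)) (Finset.mem_univ x)]
  have : ∏ y ∈ Finset.univ.erase x, siteWeight (α y) (η y)
      = ∏ y ∈ Finset.univ.erase x, siteWeight (α y) (ζ y) :=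
    Finset.prod_congr rfl fun y hy => by rw [h y (Finset.ne_of_mem_erase hy)]
  rw [this]
  ring

theorem weight_add_single {α : V → ℝ} (hα : ∀ x, 0 < α x) {η : V → ℕ} {x : V} (h : η x = 0)
    (m : ℕ) : weight α (η + Pi.single x m) = weight α η * siteWeight (α x) m := by
  have := weight_mul_siteWeight (α := α) (η := η + Pi.single x m) (ζ := η) x
    (fun y hy => by simp [hy])
  rw [h, siteWeight_zero (hα x)] at this
  simpa [h] using this

theorem weight_add_single_one {α : V → ℝ} (hα : ∀ x, 0 < α x) (η : V → ℕ) (x : V) :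
    weight α (η + Pi.single x 1) * (η x + 1) = weight α η * (α x + η x) := by
  have h := weight_mul_siteWeight (α := α) (η := η + Pi.single x 1) (ζ := η) x
    (fun y hy => by simp [hy])
  have h2 := siteWeight_succ (hα x) (η x)
  have h3 := siteWeight_pos (hα x) (η x)
  simp only [Pi.add_apply, Pi.single_eq_same] at h
  apply mul_right_cancel₀ h3.ne'
  calc _ = weight α (η + Pi.single x 1) * siteWeight (α x) (η x) * (η x + 1) := by ring
    _ = weight α η * (siteWeight (α x) (η x + 1) * (η x + 1)) := by rw [h]; ring
    _ = _ := by rw [h2]; ring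

/-- The energy of the pair `x`, `y` given the configuration `ζ` of the other particles. -/
noncomputable def pairEnergy (α : V → ℝ) (F : (V → ℕ) → ℝ) (ζ : V → ℕ) (x y : V) : ℝ :=
  weight α ζ * (α x + ζ x) * (α y + ζ y) * (F (ζ + Pi.single x 1) - F (ζ + Pi.single y 1)) ^ 2

theorem pairEnergy_nonneg {α : V → ℝ} (hα : ∀ x, 0 < α x) (F : (V → ℕ) → ℝ) (ζ : V → ℕ)
    (x y : V) : 0 ≤ pairEnergy α F ζ x y := by
  have := weight_pos hα ζ
  have := hα x
  have := hα y
  unfold pairEnergy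
  positivity

/-- All configurations of `k` particles. -/
abbrev configs (V : Type*) [Fintype V] [DecidableEq V] (k : ℕ) : Finset (V → ℕ) :=
  Finset.piAntidiag Finset.univ k

theorem mem_configs {k : ℕ} {η : V → ℕ} : η ∈ configs V k ↔ ∑ x, η x = k := by simp

theorem sum_single_univ (x : V) (m : ℕ) : ∑ y, (Pi.single x m : V → ℕ) y = m := by
  simp

/-- Substitute `η = ξ + δ_x`: the weight of `η` times `η x` equals the weight of `ξ` times `α x + ξ
x`, which makes the summand symmetric in `x` and `y`. -/
theorem dirichletForm_eq (G : WGraph V) {α : V → ℝ} (hα : ∀ x, 0 < α x) (k : ℕ)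
    (f : Config V (k + 1) → ℝ) :
    dirichletForm G α (k + 1) f = 1 / (2 * partitionFn α (k + 1)) *
      ∑ ξ ∈ configs V k, ∑ x, ∑ y, G.c x y * pairEnergy α (extend f) ξ x y := by
  have key : ∀ x y, ∑ η : Config V (k + 1),
      mu α η * G.c x y * (η.1 x : ℝ) * (α y + (η.1 y : ℝ)) * (f (η.move x y) - f η) ^ 2
      = 1 / partitionFn α (k + 1) *
        ∑ ξ ∈ configs V k, G.c x y * pairEnergy α (extend f) ξ x y := by
    intro x y
    -- The diagonal is set aside because `η y = ξ y` fails there; its conductance is zero.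
    by_cases hxy : x = y
    · subst hxy
      simp [G.self]
    rw [Finset.mul_sum]
    symm
    have hsum : ∀ ξ ∈ configs V k, ∑ z, (ξ + Pi.single x 1 : V → ℕ) z = k + 1 := by
      intro ξ hξ
      simp only [Pi.add_apply, Finset.sum_add_distrib, sum_single_univ, mem_configs.1 hξ]
    have hval : ∀ ξ (hξ : ξ ∈ configs V k) (η : Config V (k + 1)), η.1 = ξ + Pi.single x 1 →
        1 / partitionFn α (k + 1) * (G.c x y * pairEnergy α (extend f) ξ x y) =
        mu α η * G.c x y * (η.1 x : ℝ) * (α y + (η.1 y : ℝ)) * (f (η.move x y) - f η) ^ 2 := by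
      intro ξ hξ η hη
      have hmove : (η.move x y).1 = ξ + Pi.single y 1 := by
        have hx : 0 < η.1 x := by simp [hη]
        rw [Config.move, dif_pos hx]
        simp [hη]
      have hmu : mu α η * (η.1 x : ℝ)
          = 1 / partitionFn α (k + 1) * (weight α ξ * (α x + ξ x)) := by
        rw [← weight_add_single_one hα, ← hη]
        have : (η.1 x : ℝ) = ξ x + 1 := by simp [hη]
        rw [← this, ← mul_assoc]
        rfl
      have hy : η.1 y = ξ y := by simp [hη, Ne.symm hxy]
      rw [← extend_coe f η, ← extend_coe f (η.move x y), hmove, hη, pairEnergy, ← hη, hy]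
      linear_combination (-(G.c x y * (α y + ξ y) *
        (extend f (ξ + Pi.single y 1) - extend f η.1) ^ 2)) * hmu
    -- Configurations with `η x = 0` are not of the form `ξ + δ_x`, but their terms vanish.
    refine Finset.sum_bij_ne_zero
      (fun ξ hξ _ => (⟨ξ + Pi.single x 1, hsum ξ hξ⟩ : Config V (k + 1)))
      (fun _ _ _ => Finset.mem_univ _) ?_ ?_ ?_
    · intro a _ _ b _ _ h
      exact add_right_cancel (Subtype.mk.inj h)
    · intro η _ hη
      have hx : 0 < η.1 x := by
        rcases Nat.eq_zero_or_pos (η.1 x) with h | h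
        · simp [h] at hη
        · exact h
      have he : η.1 - Pi.single x 1 + Pi.single x 1 = η.1 := by
        funext z
        by_cases hz : z = x
        · subst hz
          simp only [Pi.add_apply, Pi.sub_apply, Pi.single_eq_same]
          omega
        · simp [hz]
      have hm : η.1 - Pi.single x 1 ∈ configs V k := by
        rw [mem_configs]
        have := η.2
        rw [← he] at this
        simp only [Pi.add_apply, Finset.sum_add_distrib, sum_single_univ] at this
        simpa using this
      refine ⟨_, hm, ?_, Subtype.ext he⟩
      rwa [hval _ hm η he.symm]
    · intro ξ hξ _
      exact hval ξ hξ _ rfl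
  unfold dirichletForm
  rw [Finset.sum_comm]
  simp_rw [Finset.sum_comm (s := (Finset.univ : Finset (Config V (k + 1)))), key,
    ← Finset.mul_sum]
  rw [← mul_assoc, Finset.sum_comm (s := configs V k)]
  simp_rw [Finset.sum_comm (s := configs V k), Finset.mul_sum (configs V k)]
  congr 1
  field_simp

end Weights

/-! ### Geodesics and their subdivision. -/

section Graph

variable {V : Type*}

theorem exists_geodesic {H : SimpleGraph V} (hH : H.Connected) (u v : V) :
    ∃ z : ℕ → V, z 0 = u ∧ z (H.dist u v) = v ∧
      (∀ s < H.dist u v, H.Adj (z s) (z (s + 1))) ∧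
      ∀ s ≤ H.dist u v, H.dist u (z s) = s ∧ H.dist u (z s) + H.dist (z s) v = H.dist u v := by
  obtain ⟨p, hp⟩ := hH.exists_walk_length_eq_dist u v
  refine ⟨p.getVert, by simp, by rw [← hp]; simp, fun s hs => p.adj_getVert_succ (by omega),
    fun s hs => ?_⟩
  have h1 : H.dist u (p.getVert s) ≤ s :=
    (SimpleGraph.dist_le (p.take s)).trans (by simp)
  have h2 : H.dist (p.getVert s) v ≤ H.dist u v - s :=
    (SimpleGraph.dist_le (p.drop s)).trans (by simp [hp])
  have h3 := hH.dist_triangle (u := u) (v := p.getVert s) (w := v)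
  omega

/-- Cauchy–Schwarz in a form that concatenates paths: lengths add and energies add. -/
theorem add_sq_le_of_le_mul {a b A B : ℝ} {m n : ℕ} (ha : a ^ 2 ≤ m * A) (hb : b ^ 2 ≤ n * B)
    (hA : 0 ≤ A) (hB : 0 ≤ B) : (a + b) ^ 2 ≤ ((m + n : ℕ) : ℝ) * (A + B) := by
  have h1 : |a| ≤ √m * √A := by
    rw [← Real.sqrt_mul (by positivity)]; exact Real.abs_le_sqrt ha
  have h2 : |b| ≤ √n * √B := by
    rw [← Real.sqrt_mul (by positivity)]; exact Real.abs_le_sqrt hb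
  have h3 : |a + b| ≤ √m * √A + √n * √B := (abs_add_le a b).trans (add_le_add h1 h2)
  rw [← sq_abs]
  have h4 : |a + b| ^ 2 ≤ (√m * √A + √n * √B) ^ 2 := by gcongr
  refine h4.trans ?_
  have e1 := Real.sq_sqrt (Nat.cast_nonneg (α := ℝ) m)
  have e2 := Real.sq_sqrt (Nat.cast_nonneg (α := ℝ) n)
  have e3 := Real.sq_sqrt hA
  have e4 := Real.sq_sqrt hB
  push_cast
  nth_rw 2 [← e1, ← e2, ← e3, ← e4]
  nlinarith [sq_nonneg (√m * √B - √n * √A)]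

open Classical in
/-- If `good` pairs subdivide the geodesics between `occ` points, then increments between `occ`
points are controlled by the increments over `good` pairs. -/
theorem sq_sub_le_dist_mul_sum [Fintype V] {H : SimpleGraph V} (hH : H.Connected)
    (occ : V → Prop) (good : V → V → Prop)
    (hgood : ∀ x y, occ x → occ y → x ≠ y → good x y ∨
      ∃ z, occ z ∧ z ≠ x ∧ z ≠ y ∧ H.dist x z + H.dist z y = H.dist x y)
    (hne : ∀ x y, good x y → x ≠ y) (g : V → ℝ) (x y : V) (hx : occ x) (hy : occ y) :
    (g x - g y) ^ 2 ≤ H.dist x y * ∑ p : V × V with good p.1 p.2 ∧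
      H.dist x p.1 + H.dist p.1 p.2 + H.dist p.2 y = H.dist x y,
      (g p.1 - g p.2) ^ 2 / H.dist p.1 p.2 := by
  induction hd : H.dist x y using Nat.strong_induction_on generalizing x y with
  | _ d ih =>
  have hnn : ∀ S : Finset (V × V), 0 ≤ ∑ p ∈ S, (g p.1 - g p.2) ^ 2 / (H.dist p.1 p.2 : ℝ) :=
    fun S => Finset.sum_nonneg fun p _ => by positivity
  have hmono : ∀ S T : Finset (V × V), S ⊆ T →
      ∑ p ∈ S, (g p.1 - g p.2) ^ 2 / (H.dist p.1 p.2 : ℝ)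
        ≤ ∑ p ∈ T, (g p.1 - g p.2) ^ 2 / (H.dist p.1 p.2 : ℝ) := fun S T hST =>
    Finset.sum_le_sum_of_subset_of_nonneg hST fun p _ _ => by positivity
  by_cases hxy : x = y
  · subst hxy
    rw [sub_self, zero_pow two_ne_zero]
    exact mul_nonneg (by positivity) (hnn _)
  have hdpos : ∀ {a b : V}, a ≠ b → 0 < H.dist a b := fun h => hH.pos_dist_of_ne h
  rcases hgood x y hx hy hxy with hg | ⟨z, hz, hzx, hzy, hdz⟩
  · have h0 : (0 : ℝ) < d := by
      rw [← hd]
      exact_mod_cast hdpos hxy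
    have h1 := hmono {(x, y)} (Finset.univ.filter fun p : V × V => good p.1 p.2 ∧
      H.dist x p.1 + H.dist p.1 p.2 + H.dist p.2 y = d) (by simp [hg, hd])
    rw [Finset.sum_singleton, hd] at h1
    calc (g x - g y) ^ 2 = d * ((g x - g y) ^ 2 / d) := by field_simp
      _ ≤ _ := by gcongr
  · have p1 := hdpos hzx.symm
    have p2 := hdpos hzy
    have h1 := ih _ (by omega) x z hx hz rfl
    have h2 := ih _ (by omega) z y hz hy rfl
    have h3 := add_sq_le_of_le_mul h1 h2 (hnn _) (hnn _)
    rw [sub_add_sub_cancel, ← Finset.sum_union, hdz, hd] at h3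
    · refine h3.trans (mul_le_mul_of_nonneg_left (hmono _ _ ?_) (by positivity))
      rintro ⟨u, v⟩ h
      simp only [Finset.mem_union, Finset.mem_filter, Finset.mem_univ, true_and] at h ⊢
      have t1 := hH.dist_triangle (u := v) (v := z) (w := y)
      have t2 := hH.dist_triangle (u := x) (v := u) (w := y)
      have t3 := hH.dist_triangle (u := u) (v := v) (w := y)
      have t4 := hH.dist_triangle (u := x) (v := z) (w := u)
      rcases h with ⟨h, h'⟩ | ⟨h, h'⟩
      · exact ⟨h, by omega⟩
      · exact ⟨h, by omega⟩
    -- A pair lying on geodesics of both halves would be counted twice in the length from `x` to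
    -- `y`, which is impossible as its own length is positive.
    · rw [Finset.disjoint_left]
      rintro ⟨u, v⟩ h h'
      simp only [Finset.mem_filter, Finset.mem_univ, true_and] at h h'
      have := hdpos (hne _ _ h.1)
      have t1 := hH.dist_triangle (u := x) (v := u) (w := y)
      have t2 := hH.dist_triangle (u := u) (v := v) (w := y)
      omega

end Graph

/-! ### The least conductance and sums along geodesics. -/

section Conductance

variable {V : Type*}

theorem WGraph.cMin_le (G : WGraph V) {u v : V} (h : G.toSimpleGraph.Adj u v) :
    G.cMin ≤ G.c u v :=
  csInf_le ⟨0, fun _ hr => hr.1.le⟩ ⟨h, u, v, rfl⟩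

variable [Fintype V]

theorem WGraph.cMin_pos [Nontrivial V] (G : WGraph V) (hG : G.toSimpleGraph.Connected) :
    0 < G.cMin := by
  obtain ⟨x, y, hxy⟩ := exists_pair_ne V
  obtain ⟨z, h0, -, h1, -⟩ := exists_geodesic hG x y
  have hadj := h1 0 (hG.pos_dist_of_ne hxy)
  have hfin : {r : ℝ | 0 < r ∧ ∃ x y, G.c x y = r}.Finite :=
    (Set.finite_range fun p : V × V => G.c p.1 p.2).subset
      fun r ⟨_, a, b, h⟩ => ⟨(a, b), h⟩
  have hne : {r : ℝ | 0 < r ∧ ∃ x y, G.c x y = r}.Nonempty := ⟨_, hadj, _, _, rfl⟩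
  exact (hne.csInf_mem hfin).1

/-- A sum along a geodesic is controlled by the sum over all edges. -/
theorem WGraph.sum_geodesic_le (G : WGraph V) {d : ℕ} {z : ℕ → V} {u : V}
    (hadj : ∀ s < d, G.toSimpleGraph.Adj (z s) (z (s + 1)))
    (hdist : ∀ s ≤ d, G.toSimpleGraph.dist u (z s) = s)
    {φ : V → V → ℝ} (hφ : ∀ x y, 0 ≤ φ x y) :
    G.cMin * ∑ s ∈ Finset.range d, φ (z s) (z (s + 1)) ≤ ∑ x, ∑ y, G.c x y * φ x y := by
  classical
  calc G.cMin * ∑ s ∈ Finset.range d, φ (z s) (z (s + 1))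
      ≤ ∑ s ∈ Finset.range d, G.c (z s) (z (s + 1)) * φ (z s) (z (s + 1)) := by
        rw [Finset.mul_sum]
        refine Finset.sum_le_sum fun s hs => mul_le_mul_of_nonneg_right ?_ (hφ _ _)
        exact G.cMin_le (hadj s (Finset.mem_range.1 hs))
    _ = ∑ p ∈ (Finset.range d).image fun s => (z s, z (s + 1)), G.c p.1 p.2 * φ p.1 p.2 := by
        -- The edges of the geodesic are distinct since their starting points have distinct
        -- distances from `u`.
        rw [Finset.sum_image]
        intro s hs t ht h
        have hs := Finset.mem_range.1 (Finset.mem_coe.1 hs)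
        have ht := Finset.mem_range.1 (Finset.mem_coe.1 ht)
        rw [← hdist s hs.le, ← hdist t ht.le, (Prod.mk.inj h).1]
    _ ≤ ∑ p : V × V, G.c p.1 p.2 * φ p.1 p.2 :=
        Finset.sum_le_sum_of_subset_of_nonneg (Finset.subset_univ _)
          fun p _ _ => mul_nonneg (G.nonneg _ _) (hφ _ _)
    _ = _ := Fintype.sum_prod_type _

end Conductance

/-- Fibres of `c` over distinct labels are disjoint. With `c` a `clear` map, this sums the pile
estimates over all backgrounds without multiplicity. -/
theorem sum_sum_fiber_le {ι κ β : Type*} [DecidableEq β] (S : Finset ι) (T : Finset κ)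
    {r : ι → β} (hr : Set.InjOn r S) (c : κ → β) {D : κ → ℝ} (hD : ∀ ζ, 0 ≤ D ζ) :
    ∑ ξ ∈ S, ∑ ζ ∈ T with c ζ = r ξ, D ζ ≤ ∑ ζ ∈ T, D ζ := by
  classical
  rw [← Finset.sum_biUnion]
  · exact Finset.sum_le_sum_of_subset_of_nonneg
      (Finset.biUnion_subset.2 fun ξ _ => Finset.filter_subset _ _) fun ζ _ _ => hD ζ
  · intro ξ hξ ξ' hξ' hne
    rw [Function.onFun, Finset.disjoint_left]
    intro ζ h h'
    exact hne (hr hξ hξ' ((Finset.mem_filter.1 h).2.symm.trans (Finset.mem_filter.1 h').2))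

theorem sub_sq_le_mul_sum (X : ℕ → ℝ) (n : ℕ) :
    (X 0 - X n) ^ 2 ≤ n * ∑ i ∈ Finset.range n, (X i - X (i + 1)) ^ 2 := by
  rw [← Finset.sum_range_sub' X n]
  simpa using sq_sum_le_card_mul_sum_sq (s := Finset.range n) (f := fun i => X i - X (i + 1))

/-! ### Transport of piles of particles. -/

section Piles

variable {V : Type*} [DecidableEq V]

/-- The configuration `ζ` with the sites `u`, `z`, `z'` emptied. -/
def clear (u z z' : V) (ζ : V → ℕ) : V → ℕ :=
  fun x => if x = u ∨ x = z ∨ x = z' then 0 else ζ x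

theorem single_add_single_one (x : V) {m n : ℕ} (h : n = m + 1) :
    (Pi.single x m + Pi.single x 1 : V → ℕ) = Pi.single x n := by
  rw [h, Pi.single_add]

variable [Fintype V]

/-- Particles move from `z` to `z'` one at a time; Cauchy–Schwarz costs at most `N`, and
`le_siteWeight_mul` at `z` and `z'` costs `1 / a ^ 2`. The backgrounds `ζ j i` are all distinct, as
`j` is read off at `u` and `i` at `z'`. -/
theorem pile_step_far {α : V → ℝ} {a : ℝ} (ha : 0 < a) (hα : ∀ x, a ≤ α x)
    (F : (V → ℕ) → ℝ) {k N : ℕ} {β : V → ℕ} (hβ : ∑ x, β x + N = k + 1) {u z z' : V}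
    (hu : β u = 0) (hz : β z = 0) (hz' : β z' = 0) (hzu : z ≠ u) (hzu' : z' ≠ u) (hzz : z ≠ z') :
    weight α β * ∑ j ∈ Finset.range N, siteWeight (α u) j *
      (F (β + Pi.single u j + Pi.single z (N - j)) -
        F (β + Pi.single u j + Pi.single z' (N - j))) ^ 2
    ≤ N / a ^ 2 * ∑ ζ ∈ configs V k with clear u z z' ζ = β, pairEnergy α F ζ z z' := by
  have hα' : ∀ x, 0 < α x := fun x => ha.trans_le (hα x)
  set ζ : ℕ → ℕ → V → ℕ := fun j i =>
    β + Pi.single u j + Pi.single z (N - j - 1 - i) + Pi.single z' i with hζ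
  have hζu : ∀ j i, ζ j i u = j := fun j i => by simp [hζ, hu, hzu.symm, hzu'.symm]
  have hζz : ∀ j i, ζ j i z = N - j - 1 - i := fun j i => by simp [hζ, hz, hzu, hzz]
  have hζz' : ∀ j i, ζ j i z' = i := fun j i => by simp [hζ, hz', hzu', hzz.symm]
  have hw : ∀ j i, weight α (ζ j i) = weight α β * siteWeight (α u) j *
      siteWeight (α z) (N - j - 1 - i) * siteWeight (α z') i := fun j i => by
    rw [hζ, weight_add_single hα' (by simp [hz', hzu', hzz.symm]),
      weight_add_single hα' (by simp [hz, hzu]), weight_add_single hα' hu]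
  have hstep : ∀ j ∈ Finset.range N, weight α β * (siteWeight (α u) j *
      (F (β + Pi.single u j + Pi.single z (N - j)) -
        F (β + Pi.single u j + Pi.single z' (N - j))) ^ 2)
      ≤ N / a ^ 2 * ∑ i ∈ Finset.range (N - j), pairEnergy α F (ζ j i) z z' := by
    intro j hj
    have hj := Finset.mem_range.1 hj
    have h1 := sub_sq_le_mul_sum
      (fun i => F (β + Pi.single u j + Pi.single z (N - j - i) + Pi.single z' i)) (N - j)
    simp only [Nat.sub_zero, Pi.single_zero, add_zero, Nat.sub_self] at h1
    have hNj : ((N - j : ℕ) : ℝ) ≤ N := by exact_mod_cast Nat.sub_le N j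
    have hw1 := weight_pos hα' β
    have hw2 := siteWeight_pos (hα' u) j
    calc _ ≤ weight α β * (siteWeight (α u) j * (N * ∑ i ∈ Finset.range (N - j),
          (F (β + Pi.single u j + Pi.single z (N - j - i) + Pi.single z' i) -
          F (β + Pi.single u j + Pi.single z (N - j - (i + 1)) + Pi.single z' (i + 1))) ^ 2)) := by
          gcongr
          exact h1.trans (by gcongr)
      _ = N * ∑ i ∈ Finset.range (N - j), weight α β * siteWeight (α u) j *
          (F (β + Pi.single u j + Pi.single z (N - j - i) + Pi.single z' i) -
          F (β + Pi.single u j + Pi.single z (N - j - (i + 1)) + Pi.single z' (i + 1))) ^ 2 := by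
          rw [← Finset.mul_sum]; ring
      _ ≤ N * ∑ i ∈ Finset.range (N - j), 1 / a ^ 2 * pairEnergy α F (ζ j i) z z' := by
          refine mul_le_mul_of_nonneg_left (Finset.sum_le_sum fun i hi => ?_) (by positivity)
          have hi := Finset.mem_range.1 hi
          have e1 : ζ j i + Pi.single z 1
              = β + Pi.single u j + Pi.single z (N - j - i) + Pi.single z' i := by
            simp only [hζ]
            rw [add_right_comm]
            exact congrArg₂ _ ((add_assoc _ _ _).trans
              (congrArg₂ _ rfl (single_add_single_one z (by omega)))) rfl
          have e2 : ζ j i + Pi.single z' 1 = β + Pi.single u j + Pi.single z (N - j - (i + 1))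
              + Pi.single z' (i + 1) := by
            rw [hζ, ← single_add_single_one z' (m := i) (n := i + 1) rfl, add_assoc,
              show N - j - 1 - i = N - j - (i + 1) by omega]
          rw [pairEnergy, hw, e1, e2, hζz, hζz']
          have q1 := (hα z).trans (le_siteWeight_mul (hα' z) (N - j - 1 - i))
          have q2 := (hα z').trans (le_siteWeight_mul (hα' z') i)
          have q3 := mul_le_mul q1 q2 ha.le (ha.le.trans q1)
          rw [div_mul_eq_mul_div, one_mul, le_div_iff₀ (by positivity)]
          have q4 := mul_le_mul_of_nonneg_left q3 (show 0 ≤ weight α β * siteWeight (α u) j *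
            (F (β + Pi.single u j + Pi.single z (N - j - i) + Pi.single z' i) -
            F (β + Pi.single u j + Pi.single z (N - j - (i + 1)) + Pi.single z' (i + 1))) ^ 2
            by positivity)
          linear_combination q4
      _ = _ := by rw [← Finset.mul_sum]; ring
  rw [Finset.mul_sum]
  refine (Finset.sum_le_sum hstep).trans ?_
  rw [← Finset.mul_sum, Finset.sum_sigma']
  refine mul_le_mul_of_nonneg_left ?_ (by positivity)
  rw [← Finset.sum_image (f := fun ζ => pairEnergy α F ζ z z')
    (g := fun p : Σ _ : ℕ, ℕ => ζ p.1 p.2)]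
  · refine Finset.sum_le_sum_of_subset_of_nonneg ?_ fun _ _ _ => pairEnergy_nonneg hα' _ _ _ _
    intro η hη
    obtain ⟨⟨j, i⟩, hji, rfl⟩ := Finset.mem_image.1 hη
    simp only [Finset.mem_sigma, Finset.mem_range] at hji
    rw [Finset.mem_filter, mem_configs]
    constructor
    · simp only [hζ, Pi.add_apply, Finset.sum_add_distrib, sum_single_univ]
      omega
    · funext x
      unfold clear
      split_ifs with h
      · rcases h with rfl | rfl | rfl <;> simp [*]
      · push Not at h
        simp [hζ, h.1, h.2.1, h.2.2]
  · rintro ⟨j, i⟩ _ ⟨j', i'⟩ _ h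
    have h : ζ j i = ζ j' i' := h
    have e1 := congrFun h u
    have e2 := congrFun h z'
    rw [hζu, hζu] at e1
    rw [hζz', hζz'] at e2
    rw [e1, e2]

/-- Here the moving part starts on top of the part left behind, so paths for different `j` share
their backgrounds `ζ i`. After exchanging the sums, `sum_siteWeight` shows that the rate factor at
`u` absorbs all `j < N - i` at once. -/
theorem pile_step_near {α : V → ℝ} {a : ℝ} (ha : 0 < a) (hα : ∀ x, a ≤ α x)
    (F : (V → ℕ) → ℝ) {k N : ℕ} {β : V → ℕ} (hβ : ∑ x, β x + N = k + 1) {u z : V}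
    (hu : β u = 0) (hz : β z = 0) (hzu : z ≠ u) :
    weight α β * ∑ j ∈ Finset.range N, siteWeight (α u) j *
      (F (β + Pi.single u j + Pi.single u (N - j)) -
        F (β + Pi.single u j + Pi.single z (N - j))) ^ 2
    ≤ N / a ^ 2 * ∑ ζ ∈ configs V k with clear u u z ζ = β, pairEnergy α F ζ u z := by
  have hα' : ∀ x, 0 < α x := fun x => ha.trans_le (hα x)
  set ζ : ℕ → V → ℕ := fun i => β + Pi.single u (N - 1 - i) + Pi.single z i with hζ
  have hζu : ∀ i, ζ i u = N - 1 - i := fun i => by simp [hζ, hu, hzu.symm]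
  have hζz : ∀ i, ζ i z = i := fun i => by simp [hζ, hz, hzu]
  have hw : ∀ i, weight α (ζ i) = weight α β * siteWeight (α u) (N - 1 - i) *
      siteWeight (α z) i := fun i => by
    rw [hζ, weight_add_single hα' (by simp [hz, hzu]), weight_add_single hα' hu]
  set X : ℕ → ℝ := fun i => F (β + Pi.single u (N - i) + Pi.single z i) with hX
  have hw1 := weight_pos hα' β
  have hstep : ∀ j ∈ Finset.range N, siteWeight (α u) j *
      (F (β + Pi.single u j + Pi.single u (N - j)) -
        F (β + Pi.single u j + Pi.single z (N - j))) ^ 2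
      ≤ ∑ i ∈ Finset.range (N - j), siteWeight (α u) j * (N * (X i - X (i + 1)) ^ 2) := by
    intro j hj
    have hj := Finset.mem_range.1 hj
    have h1 := sub_sq_le_mul_sum X (N - j)
    have hNj : ((N - j : ℕ) : ℝ) ≤ N := by exact_mod_cast Nat.sub_le N j
    have hw2 := siteWeight_pos (hα' u) j
    have e1 : F (β + Pi.single u j + Pi.single u (N - j)) = X 0 := by
      rw [hX, add_assoc, ← Pi.single_add, show j + (N - j) = N by omega]
      simp
    have e2 : F (β + Pi.single u j + Pi.single z (N - j)) = X (N - j) := by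
      simp only [hX, show N - (N - j) = j by omega]
    rw [e1, e2, ← Finset.mul_sum, ← Finset.mul_sum]
    gcongr
    exact h1.trans (by gcongr)
  have hstep2 : ∀ i ∈ Finset.range N, weight α β * ∑ j ∈ Finset.range (N - i),
      siteWeight (α u) j * (N * (X i - X (i + 1)) ^ 2)
      ≤ N / a ^ 2 * pairEnergy α F (ζ i) u z := by
    intro i hi
    have hi := Finset.mem_range.1 hi
    have e1 : ζ i + Pi.single u 1 = β + Pi.single u (N - i) + Pi.single z i := by
      simp only [hζ]
      rw [add_right_comm, add_assoc β]
      exact congrArg₂ _ (congrArg₂ _ rfl (single_add_single_one u (by omega))) rfl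
    have e2 : ζ i + Pi.single z 1 = β + Pi.single u (N - (i + 1)) + Pi.single z (i + 1) := by
      rw [hζ, ← single_add_single_one z (m := i) (n := i + 1) rfl, add_assoc,
        show N - 1 - i = N - (i + 1) by omega]
    have hs := sum_siteWeight (hα' u) (N - 1 - i)
    rw [show N - 1 - i + 1 = N - i by omega] at hs
    rw [← Finset.sum_mul, pairEnergy, hw, e1, e2, hζu, hζz]
    have q1 := (hα z).trans (le_siteWeight_mul (hα' z) i)
    set P := ∑ j ∈ Finset.range (N - i), siteWeight (α u) j with hP
    have hP0 : 0 ≤ P := Finset.sum_nonneg fun j _ => (siteWeight_pos (hα' u) j).le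
    have q2 : a * P ≤ siteWeight (α u) (N - 1 - i) * (α u + (N - 1 - i : ℕ)) := by
      rw [← hs]
      gcongr
      exact hα u
    have q3 := mul_le_mul q2 q1 ha.le ((by positivity : 0 ≤ a * P).trans q2)
    rw [div_mul_eq_mul_div, le_div_iff₀ (by positivity)]
    have q4 := mul_le_mul_of_nonneg_left q3
      (show 0 ≤ weight α β * N * (X i - X (i + 1)) ^ 2 by positivity)
    simp only [hX] at q4 ⊢
    linear_combination q4
  calc _ ≤ weight α β * ∑ j ∈ Finset.range N, ∑ i ∈ Finset.range (N - j),
        siteWeight (α u) j * (N * (X i - X (i + 1)) ^ 2) := by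
        gcongr with j hj
        exact hstep j hj
    _ = ∑ i ∈ Finset.range N, weight α β * ∑ j ∈ Finset.range (N - i),
        siteWeight (α u) j * (N * (X i - X (i + 1)) ^ 2) := by
        rw [← Finset.mul_sum, Finset.sum_comm']
        intro x y
        simp only [Finset.mem_range]
        omega
    _ ≤ ∑ i ∈ Finset.range N, N / a ^ 2 * pairEnergy α F (ζ i) u z := Finset.sum_le_sum hstep2
    _ ≤ _ := by
        rw [← Finset.mul_sum]
        refine mul_le_mul_of_nonneg_left ?_ (by positivity)
        rw [← Finset.sum_image (f := fun ζ => pairEnergy α F ζ u z) (g := ζ)]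
        · refine Finset.sum_le_sum_of_subset_of_nonneg ?_
            fun _ _ _ => pairEnergy_nonneg hα' _ _ _ _
          intro η hη
          obtain ⟨i, hi, rfl⟩ := Finset.mem_image.1 hη
          have hi := Finset.mem_range.1 hi
          rw [Finset.mem_filter, mem_configs]
          constructor
          · simp only [hζ, Pi.add_apply, Finset.sum_add_distrib, sum_single_univ]
            omega
          · funext x
            unfold clear
            split_ifs with h
            · rcases h with rfl | rfl | rfl <;> simp [*]
            · push Not at h
              simp [hζ, h.1, h.2.2]
        · intro i _ i' _ h
          have e2 := congrFun h z
          rwa [hζz, hζz] at e2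

/-- Moving the part of the pile at `u` that exceeds `j` from `z` to `z'`, averaged over `j`. -/
theorem pile_step {α : V → ℝ} {a : ℝ} (ha : 0 < a) (hα : ∀ x, a ≤ α x)
    (F : (V → ℕ) → ℝ) {k N : ℕ} {β : V → ℕ} (hβ : ∑ x, β x + N = k + 1) {u z z' : V}
    (hu : β u = 0) (hz : β z = 0) (hz' : β z' = 0) (hzu' : z' ≠ u) (hzz : z ≠ z') :
    weight α β * ∑ j ∈ Finset.range N, siteWeight (α u) j *
      (F (β + Pi.single u j + Pi.single z (N - j)) -
        F (β + Pi.single u j + Pi.single z' (N - j))) ^ 2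
    ≤ N / a ^ 2 * ∑ ζ ∈ configs V k with clear u z z' ζ = β, pairEnergy α F ζ z z' := by
  by_cases hzu : z = u
  · subst hzu
    exact pile_step_near ha hα F hβ hu hz' hzu'
  · exact pile_step_far ha hα F hβ hu hz hz' hzu hzu' hzz

/-- Moving one particle from the top of the pile to `v`, averaged over the part left at `u`. -/
theorem drop_step {α : V → ℝ} {a : ℝ} (ha : 0 < a) (hα : ∀ x, a ≤ α x)
    (F : (V → ℕ) → ℝ) {k N : ℕ} {β : V → ℕ} (hβ : ∑ x, β x + N = k) {u v z : V}
    (hu : β u = 0) (hz : β z = 0) (hvu : v ≠ u) (hvz : v ≠ z) :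
    weight α β * ∑ j ∈ Finset.range (N + 1), siteWeight (α u) j *
      (F (β + Pi.single u j + Pi.single z (N + 1 - j)) -
        F (β + Pi.single v 1 + Pi.single u j + Pi.single z (N - j))) ^ 2
    ≤ 1 / a ^ 2 * ∑ ζ ∈ configs V k with clear u z z ζ = β, pairEnergy α F ζ z v := by
  have hα' : ∀ x, 0 < α x := fun x => ha.trans_le (hα x)
  have hnn : ∀ ζ, 0 ≤ pairEnergy α F ζ z v := fun ζ => pairEnergy_nonneg hα' F ζ z v
  have hw := weight_pos hα' β
  have hqv : a ≤ α v + β v := (hα v).trans (by simp)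
  -- If `z = u`, the increment does not depend on `j`, and a single background, with all `N`
  -- particles at `u`, carries the whole sum.
  by_cases hzu : z = u
  · subst hzu
    have hmem : β + Pi.single z N ∈ (configs V k).filter fun ζ => clear z z z ζ = β := by
      rw [Finset.mem_filter, mem_configs]
      constructor
      · simpa only [Pi.add_apply, Finset.sum_add_distrib, sum_single_univ] using hβ
      · funext x
        unfold clear
        split_ifs with h
        · rcases h with rfl | rfl | rfl <;> simp [*]
        · push Not at h
          simp [h.1]
    refine le_trans ?_ (mul_le_mul_of_nonneg_left
      (Finset.single_le_sum (fun ζ _ => hnn ζ) hmem) (by positivity))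
    have hj : ∀ j ∈ Finset.range (N + 1), siteWeight (α z) j *
        (F (β + Pi.single z j + Pi.single z (N + 1 - j)) -
          F (β + Pi.single v 1 + Pi.single z j + Pi.single z (N - j))) ^ 2
        = siteWeight (α z) j * (F (β + Pi.single z N + Pi.single z 1) -
          F (β + Pi.single z N + Pi.single v 1)) ^ 2 := by
      intro j hj
      have hj := Finset.mem_range.1 hj
      have f1 : β + Pi.single z j + Pi.single z (N + 1 - j)
          = β + Pi.single z N + Pi.single z 1 := by
        rw [add_assoc, ← Pi.single_add, add_assoc, ← Pi.single_add,
          show j + (N + 1 - j) = N + 1 by omega]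
      have f2 : β + Pi.single v 1 + Pi.single z j + Pi.single z (N - j)
          = β + Pi.single z N + Pi.single v 1 := by
        rw [add_assoc, ← Pi.single_add, show j + (N - j) = N by omega]
        exact add_right_comm _ _ _
      rw [f1, f2]
    rw [Finset.sum_congr rfl hj, ← Finset.sum_mul, pairEnergy, weight_add_single hα' hz]
    have e1 : (β + Pi.single z N : V → ℕ) z = N := by simp [hz]
    have e2 : (β + Pi.single z N : V → ℕ) v = β v := by simp [hvz]
    rw [e1, e2, div_mul_eq_mul_div, le_div_iff₀ (by positivity)]
    have hs := sum_siteWeight (hα' z) N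
    set P := ∑ j ∈ Finset.range (N + 1), siteWeight (α z) j with hP
    have hP0 : 0 ≤ P := Finset.sum_nonneg fun j _ => (siteWeight_pos (hα' z) j).le
    have q3 := mul_le_mul (hα z) hqv ha.le (hα' z).le
    have q4 := mul_le_mul_of_nonneg_left q3 (show 0 ≤ weight α β * P *
      (F (β + Pi.single z N + Pi.single z 1) - F (β + Pi.single z N + Pi.single v 1)) ^ 2
      by positivity)
    linear_combination q4 + (weight α β * (α v + β v) *
      (F (β + Pi.single z N + Pi.single z 1) - F (β + Pi.single z N + Pi.single v 1)) ^ 2) * hs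
  · set ζ : ℕ → V → ℕ := fun j => β + Pi.single u j + Pi.single z (N - j) with hζ
    have hζu : ∀ j, ζ j u = j := fun j => by simp [hζ, hu, Ne.symm hzu]
    have hζz : ∀ j, ζ j z = N - j := fun j => by simp [hζ, hz, hzu]
    have hζv : ∀ j, ζ j v = β v := fun j => by simp [hζ, hvu, hvz]
    calc _ = ∑ j ∈ Finset.range (N + 1), weight α β * (siteWeight (α u) j *
          (F (β + Pi.single u j + Pi.single z (N + 1 - j)) -
            F (β + Pi.single v 1 + Pi.single u j + Pi.single z (N - j))) ^ 2) :=
          Finset.mul_sum _ _ _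
      _ ≤ ∑ j ∈ Finset.range (N + 1), 1 / a ^ 2 * pairEnergy α F (ζ j) z v := by
          refine Finset.sum_le_sum fun j hj => ?_
          have hj := Finset.mem_range.1 hj
          have e1 : ζ j + Pi.single z 1 = β + Pi.single u j + Pi.single z (N + 1 - j) :=
            (add_assoc _ _ _).trans (congrArg₂ _ rfl (single_add_single_one z (by omega)))
          have e2 : ζ j + Pi.single v 1
              = β + Pi.single v 1 + Pi.single u j + Pi.single z (N - j) := by
            simp only [hζ]
            rw [add_right_comm]
            exact congrArg₂ _ (add_right_comm _ _ _) rfl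
          have hwζ : weight α (ζ j) = weight α β * siteWeight (α u) j *
              siteWeight (α z) (N - j) := by
            rw [hζ, weight_add_single hα' (by simp [hz, hzu]), weight_add_single hα' hu]
          rw [pairEnergy, hwζ, e1, e2, hζz, hζv]
          have q1 := (hα z).trans (le_siteWeight_mul (hα' z) (N - j))
          have q3 := mul_le_mul q1 hqv ha.le (ha.le.trans q1)
          have hw2 := siteWeight_pos (hα' u) j
          rw [div_mul_eq_mul_div, one_mul, le_div_iff₀ (by positivity)]
          have q4 := mul_le_mul_of_nonneg_left q3 (show 0 ≤ weight α β * siteWeight (α u) j *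
            (F (β + Pi.single u j + Pi.single z (N + 1 - j)) -
            F (β + Pi.single v 1 + Pi.single u j + Pi.single z (N - j))) ^ 2 by positivity)
          linear_combination q4
      _ ≤ _ := by
          rw [← Finset.mul_sum]
          refine mul_le_mul_of_nonneg_left ?_ (by positivity)
          rw [← Finset.sum_image (f := fun ζ => pairEnergy α F ζ z v) (g := ζ)]
          · refine Finset.sum_le_sum_of_subset_of_nonneg ?_ fun _ _ _ => hnn _
            intro η hη
            obtain ⟨j, hj, rfl⟩ := Finset.mem_image.1 hη
            have hj := Finset.mem_range.1 hj
            rw [Finset.mem_filter, mem_configs]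
            constructor
            · simp only [hζ, Pi.add_apply, Finset.sum_add_distrib, sum_single_univ]
              omega
            · funext x
              unfold clear
              split_ifs with h
              · rcases h with rfl | rfl | rfl <;> simp [*]
              · push Not at h
                simp [hζ, h.1, h.2.1]
          · intro i _ i' _ h
            have e2 := congrFun h u
            rwa [hζu, hζu] at e2

/-- The energy of a pair of occupied sites `u`, `v` joined by a path with empty interior. -/
theorem weight_mul_sq_le {α : V → ℝ} {a A : ℝ} (ha : 0 < a) (hα : ∀ x, a ≤ α x)
    (hA : ∀ x, α x ≤ A) (F : (V → ℕ) → ℝ) {k m : ℕ} {ξ : V → ℕ} (hξ : ∑ x, ξ x = k)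
    {z : ℕ → V} (hz : ∀ s ≤ m + 1, ∀ t ≤ m + 1, z s = z t → s = t)
    (hu : 1 ≤ ξ (z 0)) (hv : 1 ≤ ξ (z (m + 1))) (hempty : ∀ s, 0 < s → s ≤ m → ξ (z s) = 0) :
    weight α ξ * (F (ξ + Pi.single (z 0) 1) - F (ξ + Pi.single (z (m + 1)) 1)) ^ 2 ≤
      (2 * m + 1) * (A / a ^ 2) *
        ((∑ s ∈ Finset.range m, 2 * ∑ ζ ∈ configs V k with
            clear (z 0) (z s) (z (s + 1)) ζ = Function.update ξ (z 0) 0,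
            pairEnergy α F ζ (z s) (z (s + 1))) +
          (∑ ζ ∈ configs V k with clear (z 0) (z m) (z m) ζ = Function.update ξ (z 0) 0,
            pairEnergy α F ζ (z m) (z (m + 1))) +
          ∑ s ∈ Finset.range m, 2 * ∑ ζ ∈ configs V k with
            clear (z 0) (z s) (z (s + 1)) ζ
              = Function.update ξ (z 0) 0 + Pi.single (z (m + 1)) 1,
            pairEnergy α F ζ (z s) (z (s + 1))) := by
  have hα' : ∀ x, 0 < α x := fun x => ha.trans_le (hα x)
  have hzne : ∀ s ≤ m + 1, ∀ t ≤ m + 1, s ≠ t → z s ≠ z t :=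
    fun s hs t ht h h' => h (hz s hs t ht h')
  set u := z 0 with hu0
  set v := z (m + 1) with hv0
  have hvu : v ≠ u := hzne _ le_rfl _ (by omega) (by omega)
  set n := ξ u with hn
  set β := Function.update ξ u 0 with hβ
  have hβu : β u = 0 := by simp [hβ]
  have hβv : β v = ξ v := by simp [hβ, hvu]
  have hβz : ∀ s ≤ m, β (z s) = 0 := by
    intro s hs
    rcases Nat.eq_zero_or_pos s with rfl | h
    · exact hβu
    · rw [hβ, Function.update_of_ne (hzne _ (by omega) _ (by omega) (by omega))]
      exact hempty s h hs
  have hξβ : ξ = β + Pi.single u n := by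
    funext x
    by_cases hx : x = u
    · subst hx
      simp [hβ, hn]
    · simp [hβ, hx]
  have hβsum : ∑ x, β x + n = k := by
    rw [← hξ]
    conv_rhs => rw [hξβ]
    simp only [Pi.add_apply, Finset.sum_add_distrib, sum_single_univ]
  set β' := β + Pi.single v 1 with hβ'
  have hβ'u : β' u = 0 := by simp [hβ', hβu, hvu.symm]
  have hβ'z : ∀ s ≤ m, β' (z s) = 0 := by
    intro s hs
    have hne : z s ≠ v := hzne s (by omega) (m + 1) le_rfl (by omega)
    simp [hβ', hβz s hs, hne]
  have hβ'sum : ∑ x, β' x + n = k + 1 := by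
    simp only [hβ', Pi.add_apply, Finset.sum_add_distrib, sum_single_univ]
    omega
  have hwβ := weight_pos hα' β
  have hwβ' := weight_pos hα' β'
  have hn1 : (1 : ℝ) ≤ n := by exact_mod_cast hu
  have hαu := hα' u
  have hαA := hA u
  -- Occupation of `v` enters here: the ratio of the weights is `(β v + 1) / (α v + β v)`, at most
  -- `2` when `β v ≥ 1`.
  have hββ' : weight α β ≤ 2 * weight α β' := by
    have h1 := weight_add_single_one hα' β v
    have h2 : (1 : ℝ) ≤ β v := by rw [hβv]; exact_mod_cast hv
    have h3 := hα' v
    have h4 : weight α β * (β v + 1) ≤ 2 * weight α β' * (β v + 1) := by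
      rw [mul_assoc, h1]
      nlinarith
    exact le_of_mul_le_mul_right h4 (by positivity)
  -- The normalization of the average over `j`. The bounds on `c * (n + 1)` and `c * n` cancel the
  -- Cauchy–Schwarz cost of moving a pile; the first uses `n ≥ 1`.
  set c := α u / (α u + n) with hc
  have hc0 : 0 ≤ c := by positivity
  have hc1 : c ≤ A := by
    rw [hc, div_le_iff₀ (by positivity)]
    nlinarith
  have hc2 : c * (n + 1) ≤ 2 * A := by
    rw [hc, div_mul_eq_mul_div, div_le_iff₀ (by positivity)]
    nlinarith
  have hc3 : c * n ≤ A := by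
    rw [hc, div_mul_eq_mul_div, div_le_iff₀ (by positivity)]
    nlinarith
  have hwξ : weight α ξ = c * (weight α β * ∑ j ∈ Finset.range (n + 1), siteWeight (α u) j) := by
    rw [hξβ, weight_add_single hα' hβu, hc]
    have := sum_siteWeight hαu n
    field_simp
    linear_combination -this
  -- `X j` is the outward journey and `Y j` the journey back, read in reverse, after one particle
  -- has been dropped at `v`.
  set X : ℕ → ℕ → ℝ := fun j s => F (β + Pi.single u j + Pi.single (z s) (n + 1 - j)) with hX
  set Y : ℕ → ℕ → ℝ := fun j s => F (β' + Pi.single u j + Pi.single (z s) (n - j)) with hY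
  have hpath : ∀ j ∈ Finset.range (n + 1),
      (F (ξ + Pi.single u 1) - F (ξ + Pi.single v 1)) ^ 2 ≤ (2 * m + 1) *
        ((∑ s ∈ Finset.range m, (X j s - X j (s + 1)) ^ 2) + (X j m - Y j m) ^ 2 +
          ∑ s ∈ Finset.range m, (Y j s - Y j (s + 1)) ^ 2) := by
    intro j hj
    have hj := Finset.mem_range.1 hj
    have e1 : F (ξ + Pi.single u 1) = X j 0 := by
      simp only [hX]
      rw [← hu0, add_assoc, ← Pi.single_add, hξβ, add_assoc, ← Pi.single_add,
        show j + (n + 1 - j) = n + 1 by omega]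
    have e2 : F (ξ + Pi.single v 1) = Y j 0 := by
      simp only [hY]
      rw [← hu0, add_assoc, ← Pi.single_add, hξβ, add_right_comm,
        show j + (n - j) = n by omega]
    have h1 := sub_sq_le_mul_sum (X j) m
    have h2 := sub_sq_le_mul_sum (Y j) m
    have h3 : (X j m - Y j m) ^ 2 ≤ (1 : ℕ) * (X j m - Y j m) ^ 2 := by simp
    rw [← neg_sub, neg_sq] at h2
    have h4 := add_sq_le_of_le_mul (add_sq_le_of_le_mul h1 h3 (by positivity) (by positivity)) h2
      (by positivity) (by positivity)
    rw [e1, e2]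
    push_cast at h4
    refine le_trans (le_of_eq ?_) (h4.trans (le_of_eq ?_)) <;> ring
  have hXs : ∀ s ∈ Finset.range m, c * (weight α β * ∑ j ∈ Finset.range (n + 1),
      siteWeight (α u) j * (X j s - X j (s + 1)) ^ 2) ≤ A / a ^ 2 * (2 * ∑ ζ ∈ configs V k with
        clear u (z s) (z (s + 1)) ζ = β, pairEnergy α F ζ (z s) (z (s + 1))) := by
    intro s hs
    have hs := Finset.mem_range.1 hs
    have h := pile_step ha hα F (k := k) (N := n + 1) (by omega) hβu (hβz s hs.le)
      (hβz (s + 1) hs) (hzne (s + 1) (by omega) 0 (by omega) (by omega))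
      (hzne s (by omega) (s + 1) (by omega) (by omega))
    set T := ∑ ζ ∈ configs V k with
        clear u (z s) (z (s + 1)) ζ = β, pairEnergy α F ζ (z s) (z (s + 1))
    have hT : 0 ≤ T := Finset.sum_nonneg fun ζ _ => pairEnergy_nonneg hα' F ζ _ _
    calc _ ≤ c * (((n + 1 : ℕ) : ℝ) / a ^ 2 * T) := mul_le_mul_of_nonneg_left h hc0
      _ = (c * (n + 1)) * (T / a ^ 2) := by push_cast; ring
      _ ≤ 2 * A * (T / a ^ 2) := by gcongr
      _ = _ := by ring
  have hYs : ∀ s ∈ Finset.range m, c * (weight α β * ∑ j ∈ Finset.range (n + 1),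
      siteWeight (α u) j * (Y j s - Y j (s + 1)) ^ 2) ≤ A / a ^ 2 * (2 * ∑ ζ ∈ configs V k with
        clear u (z s) (z (s + 1)) ζ = β', pairEnergy α F ζ (z s) (z (s + 1))) := by
    intro s hs
    have hs := Finset.mem_range.1 hs
    have h := pile_step ha hα F (N := n) hβ'sum hβ'u (hβ'z s hs.le)
      (hβ'z (s + 1) hs) (hzne (s + 1) (by omega) 0 (by omega) (by omega))
      (hzne s (by omega) (s + 1) (by omega) (by omega))
    set T := ∑ ζ ∈ configs V k with
        clear u (z s) (z (s + 1)) ζ = β', pairEnergy α F ζ (z s) (z (s + 1))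
    have hT : 0 ≤ T := Finset.sum_nonneg fun ζ _ => pairEnergy_nonneg hα' F ζ _ _
    -- For `j = n` a single particle was carried out, so nothing travels back.
    have hlast : siteWeight (α u) n * (Y n s - Y n (s + 1)) ^ 2 = 0 := by simp [hY]
    rw [Finset.sum_range_succ, hlast, add_zero]
    have hS : 0 ≤ ∑ j ∈ Finset.range n, siteWeight (α u) j * (Y j s - Y j (s + 1)) ^ 2 :=
      Finset.sum_nonneg fun j _ => mul_nonneg (siteWeight_pos hαu j).le (sq_nonneg _)
    calc _ ≤ c * (2 * weight α β' *
          ∑ j ∈ Finset.range n, siteWeight (α u) j * (Y j s - Y j (s + 1)) ^ 2) := by gcongr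
      _ ≤ c * (2 * ((n : ℝ) / a ^ 2 * T)) := by
          rw [mul_assoc 2]
          exact mul_le_mul_of_nonneg_left (mul_le_mul_of_nonneg_left h two_pos.le) hc0
      _ = (c * n) * (2 * (T / a ^ 2)) := by ring
      _ ≤ A * (2 * (T / a ^ 2)) := by gcongr
      _ = _ := by ring
  have hXY : c * (weight α β * ∑ j ∈ Finset.range (n + 1),
      siteWeight (α u) j * (X j m - Y j m) ^ 2) ≤ A / a ^ 2 * ∑ ζ ∈ configs V k with
        clear u (z m) (z m) ζ = β, pairEnergy α F ζ (z m) v := by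
    have h := drop_step ha hα F hβsum hβu (hβz m le_rfl) hvu
      (hzne (m + 1) le_rfl m (by omega) (by omega))
    set T := ∑ ζ ∈ configs V k with clear u (z m) (z m) ζ = β, pairEnergy α F ζ (z m) v
    have hT : 0 ≤ T := Finset.sum_nonneg fun ζ _ => pairEnergy_nonneg hα' F ζ _ _
    calc _ ≤ c * (1 / a ^ 2 * T) := mul_le_mul_of_nonneg_left h hc0
      _ ≤ A * (1 / a ^ 2 * T) := by gcongr
      _ = _ := by ring
  calc _ = c * (weight α β * ∑ j ∈ Finset.range (n + 1), siteWeight (α u) j *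
        (F (ξ + Pi.single u 1) - F (ξ + Pi.single v 1)) ^ 2) := by
        rw [hwξ, ← Finset.sum_mul]; ring
    _ ≤ c * (weight α β * ∑ j ∈ Finset.range (n + 1), siteWeight (α u) j * ((2 * m + 1) *
        ((∑ s ∈ Finset.range m, (X j s - X j (s + 1)) ^ 2) + (X j m - Y j m) ^ 2 +
          ∑ s ∈ Finset.range m, (Y j s - Y j (s + 1)) ^ 2))) := by
        refine mul_le_mul_of_nonneg_left (mul_le_mul_of_nonneg_left
          (Finset.sum_le_sum fun j hj => ?_) hwβ.le) hc0
        exact mul_le_mul_of_nonneg_left (hpath j hj) (siteWeight_pos hαu j).le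
    _ = (2 * m + 1) * ((∑ s ∈ Finset.range m, c * (weight α β * ∑ j ∈ Finset.range (n + 1),
          siteWeight (α u) j * (X j s - X j (s + 1)) ^ 2)) +
        c * (weight α β * ∑ j ∈ Finset.range (n + 1),
          siteWeight (α u) j * (X j m - Y j m) ^ 2) +
        ∑ s ∈ Finset.range m, c * (weight α β * ∑ j ∈ Finset.range (n + 1),
          siteWeight (α u) j * (Y j s - Y j (s + 1)) ^ 2)) := by
        simp_rw [← Finset.mul_sum]
        rw [Finset.sum_comm, Finset.sum_comm (s := Finset.range m)]
        simp_rw [← Finset.mul_sum, mul_left_comm (siteWeight (α u) _), mul_add,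
          Finset.sum_add_distrib, ← Finset.mul_sum]
        ring
    _ ≤ (2 * m + 1) * ((∑ s ∈ Finset.range m, A / a ^ 2 * (2 * ∑ ζ ∈ configs V k with
          clear u (z s) (z (s + 1)) ζ = β, pairEnergy α F ζ (z s) (z (s + 1)))) +
        A / a ^ 2 * (∑ ζ ∈ configs V k with
          clear u (z m) (z m) ζ = β, pairEnergy α F ζ (z m) v) +
        ∑ s ∈ Finset.range m, A / a ^ 2 * (2 * ∑ ζ ∈ configs V k with
          clear u (z s) (z (s + 1)) ζ = β', pairEnergy α F ζ (z s) (z (s + 1)))) := by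
        refine mul_le_mul_of_nonneg_left ?_ (by positivity)
        exact add_le_add (add_le_add (Finset.sum_le_sum hXs) hXY) (Finset.sum_le_sum hYs)
    _ = _ := by
        rw [← Finset.mul_sum _ _ (A / a ^ 2), ← Finset.mul_sum _ _ (A / a ^ 2)]
        ring

/-! ### Summation over backgrounds and comparison of the forms. -/

/-- The fixed total number of particles restores the emptied site. The shift `γ` is `0` on the way
out and `δ_v` on the way back. -/
theorem update_injOn_configs (k : ℕ) (u : V) (γ : V → ℕ) :
    Set.InjOn (fun ξ : V → ℕ => Function.update ξ u 0 + γ) (configs V k) := by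
  intro ξ hξ η hη h
  have h : Function.update ξ u 0 = Function.update η u 0 := add_right_cancel h
  have hξ := mem_configs.1 (Finset.mem_coe.1 hξ)
  have hη := mem_configs.1 (Finset.mem_coe.1 hη)
  have hne : ∀ x, x ≠ u → ξ x = η x := fun x hx => by simpa [hx] using congrFun h x
  have h1 := (Finset.add_sum_erase Finset.univ ξ (Finset.mem_univ u)).trans hξ
  have h2 := (Finset.add_sum_erase Finset.univ η (Finset.mem_univ u)).trans hη
  have h3 : ∑ x ∈ Finset.univ.erase u, ξ x = ∑ x ∈ Finset.univ.erase u, η x :=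
    Finset.sum_congr rfl fun x hx => hne x (Finset.ne_of_mem_erase hx)
  funext x
  by_cases hx : x = u
  · subst hx
    omega
  · exact hne x hx

theorem cMin_mul_sum_good_le (G : WGraph V) {α : V → ℝ} {a A : ℝ}
    (ha : 0 < a) (hα : ∀ x, a ≤ α x) (hA : ∀ x, α x ≤ A) (F : (V → ℕ) → ℝ) {k d : ℕ}
    (hd : d ≠ 0) {u v : V} {z : ℕ → V} (hz0 : z 0 = u) (hzd : z d = v)
    (hadj : ∀ s < d, G.toSimpleGraph.Adj (z s) (z (s + 1)))
    (hdist : ∀ s ≤ d, G.toSimpleGraph.dist u (z s) = s)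
    {S : Finset (V → ℕ)} (hS : S ⊆ configs V k) (hu : ∀ ξ ∈ S, 1 ≤ ξ u) (hv : ∀ ξ ∈ S, 1 ≤ ξ v)
    (hempty : ∀ ξ ∈ S, ∀ s, 0 < s → s < d → ξ (z s) = 0) (hc : 0 ≤ G.cMin) :
    G.cMin * ∑ ξ ∈ S, weight α ξ * ((F (ξ + Pi.single u 1) - F (ξ + Pi.single v 1)) ^ 2 / d) ≤
      8 * (A / a ^ 2) * ∑ x, ∑ y, G.c x y * ∑ ζ ∈ configs V k, pairEnergy α F ζ x y := by
  obtain ⟨m, rfl⟩ := Nat.exists_eq_succ_of_ne_zero hd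
  subst hz0 hzd
  have hα' : ∀ x, 0 < α x := fun x => ha.trans_le (hα x)
  have hA0 : 0 ≤ A := (hα' (z 0)).le.trans (hA _)
  have hinj : ∀ s ≤ m + 1, ∀ t ≤ m + 1, z s = z t → s = t := fun s hs t ht h => by
    rw [← hdist s hs, ← hdist t ht, h]
  have hnn : ∀ x y ζ, 0 ≤ pairEnergy α F ζ x y := fun x y ζ => pairEnergy_nonneg hα' F ζ x y
  set T : ℕ → ℝ := fun s => ∑ ζ ∈ configs V k, pairEnergy α F ζ (z s) (z (s + 1)) with hT
  have hT0 : ∀ s, 0 ≤ T s := fun s => Finset.sum_nonneg fun ζ _ => hnn _ _ ζ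
  have hfib : ∀ (w : V) (γ : V → ℕ) (s : ℕ), ∑ ξ ∈ S, ∑ ζ ∈ configs V k with
      clear (z 0) (z s) w ζ = Function.update ξ (z 0) 0 + γ,
      pairEnergy α F ζ (z s) (z (s + 1)) ≤ T s := fun w γ s =>
    sum_sum_fiber_le S (configs V k)
      ((update_injOn_configs k (z 0) γ).mono (Finset.coe_subset.2 hS)) _ (hnn _ _)
  have hfib0 : ∀ (w : V) (s : ℕ), ∑ ξ ∈ S, ∑ ζ ∈ configs V k with
      clear (z 0) (z s) w ζ = Function.update ξ (z 0) 0,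
      pairEnergy α F ζ (z s) (z (s + 1)) ≤ T s := fun w s => by
    simpa using hfib w 0 s
  have hpair : ∑ ξ ∈ S, weight α ξ *
      (F (ξ + Pi.single (z 0) 1) - F (ξ + Pi.single (z (m + 1)) 1)) ^ 2 ≤
      (2 * m + 1) * (A / a ^ 2) * (4 * ∑ s ∈ Finset.range (m + 1), T s) := by
    refine (Finset.sum_le_sum fun ξ hξ => weight_mul_sq_le ha hα hA F
      (mem_configs.1 (hS hξ)) hinj (hu ξ hξ) (hv ξ hξ)
      (fun s h h' => hempty ξ hξ s h (by omega))).trans ?_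
    rw [← Finset.mul_sum]
    refine mul_le_mul_of_nonneg_left ?_ (by positivity)
    rw [Finset.sum_add_distrib, Finset.sum_add_distrib, Finset.sum_comm,
      Finset.sum_comm (s := S) (t := Finset.range m)]
    simp_rw [← Finset.mul_sum]
    have h1 := Finset.sum_le_sum fun s (_ : s ∈ Finset.range m) => hfib0 (z (s + 1)) s
    have h2 := Finset.sum_le_sum fun s (_ : s ∈ Finset.range m) =>
      hfib (z (s + 1)) (Pi.single (z (m + 1)) 1) s
    have h3 := hfib0 (z m) m
    rw [Finset.sum_range_succ]
    linarith [hT0 m]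
  have hgeo := G.sum_geodesic_le hadj hdist
    (φ := fun x y => ∑ ζ ∈ configs V k, pairEnergy α F ζ x y)
    (fun x y => Finset.sum_nonneg fun ζ _ => hnn _ _ ζ)
  have hTs : 0 ≤ ∑ s ∈ Finset.range (m + 1), T s := Finset.sum_nonneg fun s _ => hT0 s
  have hm : (0 : ℝ) < (m + 1 : ℕ) := by positivity
  calc _ = G.cMin * ((∑ ξ ∈ S, weight α ξ *
        (F (ξ + Pi.single (z 0) 1) - F (ξ + Pi.single (z (m + 1)) 1)) ^ 2) / (m + 1 : ℕ)) := by
        rw [Finset.sum_div]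
        simp_rw [mul_div_assoc]
    _ ≤ G.cMin * (8 * (A / a ^ 2) * ∑ s ∈ Finset.range (m + 1), T s) := by
        refine mul_le_mul_of_nonneg_left ?_ hc
        -- Each edge is used with factor at most `2 + 2`, and `4 * (2 * m + 1) ≤ 8 * (m + 1)`.
        rw [div_le_iff₀ hm]
        refine hpair.trans ?_
        push_cast
        have : 0 ≤ A / a ^ 2 * ∑ s ∈ Finset.range (m + 1), T s := by positivity
        linarith
    _ = 8 * (A / a ^ 2) * (G.cMin * ∑ s ∈ Finset.range (m + 1), T s) := by ring
    _ ≤ _ := mul_le_mul_of_nonneg_left hgeo (by positivity)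

/-- The comparison along a geodesic for a fixed configuration. -/
theorem cMin_mul_weight_mul_sq_le (G : WGraph V) (hG : G.toSimpleGraph.Connected) {α : V → ℝ}
    {a : ℝ} (ha : 0 < a) (hα : ∀ x, a ≤ α x) (F : (V → ℕ) → ℝ) (ξ : V → ℕ) (x y : V) :
    G.cMin * a ^ 2 * (weight α ξ * (F (ξ + Pi.single x 1) - F (ξ + Pi.single y 1)) ^ 2) ≤
      G.toSimpleGraph.dist x y * ∑ u, ∑ v, G.c u v * pairEnergy α F ξ u v := by
  have hα' : ∀ x, 0 < α x := fun x => ha.trans_le (hα x)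
  obtain ⟨z, h0, h1, hadj, hdist⟩ := exists_geodesic hG x y
  have hw := weight_pos hα' ξ
  set g : V → ℝ := fun x => F (ξ + Pi.single x 1) with hg
  have hle : ∀ u v, a ^ 2 * (weight α ξ * (g u - g v) ^ 2) ≤ pairEnergy α F ξ u v := by
    intro u v
    have q1 : a ≤ α u + ξ u := (hα u).trans (by simp)
    have q2 : a ≤ α v + ξ v := (hα v).trans (by simp)
    have q3 := mul_le_mul q1 q2 ha.le (ha.le.trans q1)
    have q4 := mul_le_mul_of_nonneg_left q3 (show 0 ≤ weight α ξ * (g u - g v) ^ 2 by positivity)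
    unfold pairEnergy
    linear_combination q4
  have hp := sub_sq_le_mul_sum (fun s => g (z s)) (G.toSimpleGraph.dist x y)
  simp only [h0, h1] at hp
  have hgeo := G.sum_geodesic_le hadj (fun s hs => (hdist s hs).1)
    (φ := fun u v => a ^ 2 * (weight α ξ * (g u - g v) ^ 2)) (fun u v => by positivity)
  -- On a one-point graph `cMin` is the infimum of the empty set, hence `0`.
  rcases le_total G.cMin 0 with hc | hc
  · refine (mul_nonpos_of_nonpos_of_nonneg (mul_nonpos_of_nonpos_of_nonneg hc (by positivity))
      (by positivity)).trans (mul_nonneg (by positivity) ?_)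
    exact Finset.sum_nonneg fun u _ => Finset.sum_nonneg fun v _ =>
      mul_nonneg (G.nonneg _ _) (pairEnergy_nonneg hα' _ _ _ _)
  calc _ ≤ G.cMin * a ^ 2 * (weight α ξ * (G.toSimpleGraph.dist x y *
        ∑ s ∈ Finset.range (G.toSimpleGraph.dist x y), (g (z s) - g (z (s + 1))) ^ 2)) := by
        gcongr
    _ = G.toSimpleGraph.dist x y * (G.cMin * ∑ s ∈ Finset.range (G.toSimpleGraph.dist x y),
        a ^ 2 * (weight α ξ * (g (z s) - g (z (s + 1))) ^ 2)) := by
        rw [← Finset.mul_sum, ← Finset.mul_sum]; ring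
    _ ≤ G.toSimpleGraph.dist x y *
        ∑ u, ∑ v, G.c u v * (a ^ 2 * (weight α ξ * (g u - g v) ^ 2)) := by gcongr
    _ ≤ _ := by
        refine mul_le_mul_of_nonneg_left ?_ (by positivity)
        exact Finset.sum_le_sum fun u _ => Finset.sum_le_sum fun v _ =>
          mul_le_mul_of_nonneg_left (hle u v) (G.nonneg _ _)

open Classical in
/-- Comparison of the unnormalized Dirichlet forms. -/
theorem sum_pairEnergy_le [Nontrivial V] (G : WGraph V) (hG : G.toSimpleGraph.Connected)
    {α : V → ℝ} {a A : ℝ} (ha : 0 < a) (hα : ∀ x, a ≤ α x) (hA : ∀ x, α x ≤ A)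
    (F : (V → ℕ) → ℝ) (k : ℕ) :
    ∑ ξ ∈ configs V k, ∑ x, ∑ y, pairEnergy α F ξ x y ≤
      G.toSimpleGraph.diam * A / (a ^ 2 * G.cMin) *
        (8 * (Fintype.card V : ℝ) ^ 2 * (1 + A) ^ 2 * (k : ℝ) ^ 2 +
          2 * (Fintype.card V : ℝ) ^ 2 * A + 2 * Fintype.card V * k) *
        ∑ ξ ∈ configs V k, ∑ x, ∑ y, G.c x y * pairEnergy α F ξ x y := by
  have hα' : ∀ x, 0 < α x := fun x => ha.trans_le (hα x)
  have hc := G.cMin_pos hG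
  have hA0 : 0 < A := (hα' hG.nonempty.some).trans_le (hA _)
  set H := G.toSimpleGraph with hH
  have hdiam : ∀ x y, (H.dist x y : ℝ) ≤ H.diam := fun x y => by
    exact_mod_cast SimpleGraph.dist_le_diam (SimpleGraph.connected_iff_ediam_ne_top.1 hG)
  choose z hz0 hzd hadj hdist using fun u v => exists_geodesic hG u v
  set n : ℝ := (Fintype.card V : ℝ) with hn
  set good : (V → ℕ) → V → V → Prop := fun ξ u v => u ≠ v ∧ 1 ≤ ξ u ∧ 1 ≤ ξ v ∧
    ∀ s, 0 < s → s < H.dist u v → ξ (z u v s) = 0 with hgood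
  set R : (V → ℕ) → ℝ := fun ξ => ∑ p : V × V with good ξ p.1 p.2,
    (F (ξ + Pi.single p.1 1) - F (ξ + Pi.single p.2 1)) ^ 2 / H.dist p.1 p.2 with hR
  have hR0 : ∀ ξ, 0 ≤ R ξ := fun ξ => Finset.sum_nonneg fun p _ => by positivity
  set E : (V → ℕ) → ℝ := fun ξ => ∑ x, ∑ y, G.c x y * pairEnergy α F ξ x y with hE
  have hE0 : ∀ ξ, 0 ≤ E ξ := fun ξ => Finset.sum_nonneg fun u _ => Finset.sum_nonneg fun v _ =>
    mul_nonneg (G.nonneg _ _) (pairEnergy_nonneg hα' _ _ _ _)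
  have hocc : ∀ ξ x y, 1 ≤ ξ x → 1 ≤ ξ y →
      (F (ξ + Pi.single x 1) - F (ξ + Pi.single y 1)) ^ 2 ≤ H.diam * R ξ := by
    intro ξ x y hx hy
    have h := sq_sub_le_dist_mul_sum hG (fun x => 1 ≤ ξ x) (good ξ) ?_ (fun x y h => h.1)
      (fun x => F (ξ + Pi.single x 1)) x y hx hy
    · refine h.trans (mul_le_mul (hdiam x y) ?_ ?_ (by positivity))
      · refine Finset.sum_le_sum_of_subset_of_nonneg ?_ fun p _ _ => by positivity
        intro p hp
        simp only [Finset.mem_filter, Finset.mem_univ, true_and] at hp ⊢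
        exact hp.1
      · exact Finset.sum_nonneg fun p _ => by positivity
    · intro x y hx hy hxy
      by_cases hg : good ξ x y
      · exact Or.inl hg
      · right
        -- A pair of occupied sites that is not good has an occupied site inside its chosen
        -- geodesic, where the geodesic is cut.
        simp only [hgood, not_and, not_forall] at hg
        obtain ⟨s, hs0, hs1, hs⟩ := hg hxy hx hy
        have hd := hdist x y s hs1.le
        refine ⟨z x y s, Nat.one_le_iff_ne_zero.2 hs, ?_, ?_, hd.2⟩
        · intro h
          rw [h, SimpleGraph.dist_self] at hd
          omega
        · intro h
          rw [h] at hd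
          omega
  have hone : ∀ ξ x y, pairEnergy α F ξ x y ≤
      (1 + A) ^ 2 * (ξ x * ξ y) * (H.diam * (weight α ξ * R ξ)) +
      A * (2 * A + ξ x + ξ y) * (H.diam / (a ^ 2 * G.cMin) * E ξ) := by
    intro ξ x y
    have hw := weight_pos hα' ξ
    have hx0 := hα' x
    have hy0 := hα' y
    have hxA := hA x
    have hyA := hA y
    have hR1 := hR0 ξ
    have hE1 := hE0 ξ
    have hdg : weight α ξ * (F (ξ + Pi.single x 1) - F (ξ + Pi.single y 1)) ^ 2
        ≤ H.diam / (a ^ 2 * G.cMin) * E ξ := by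
      have h := cMin_mul_weight_mul_sq_le G hG ha hα F ξ x y
      have h2 : H.dist x y * E ξ ≤ H.diam * E ξ :=
        mul_le_mul_of_nonneg_right (hdiam x y) (hE0 ξ)
      rw [div_mul_eq_mul_div, le_div_iff₀ (by positivity)]
      linarith
    -- Two occupied sites use the subdivision into good pairs; otherwise the frozen-background bound
    -- suffices.
    by_cases hxy : 1 ≤ ξ x ∧ 1 ≤ ξ y
    · have h1 : (1 : ℝ) ≤ ξ x := by exact_mod_cast hxy.1
      have h2 : (1 : ℝ) ≤ ξ y := by exact_mod_cast hxy.2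
      have h3 : α x + ξ x ≤ (1 + A) * ξ x := by nlinarith
      have h4 : α y + ξ y ≤ (1 + A) * ξ y := by nlinarith
      have h5 := hocc ξ x y hxy.1 hxy.2
      have h6 : 0 ≤ A * (2 * A + ξ x + ξ y) * (H.diam / (a ^ 2 * G.cMin) * E ξ) := by positivity
      have h7 : pairEnergy α F ξ x y ≤
          weight α ξ * ((1 + A) * ξ x) * ((1 + A) * ξ y) * (H.diam * R ξ) := by
        unfold pairEnergy
        gcongr
      linarith
    · have h3 : (α x + ξ x) * (α y + ξ y) ≤ A * (2 * A + ξ x + ξ y) := by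
        rcases Nat.eq_zero_or_pos (ξ x) with h | h
        · rw [h, Nat.cast_zero, add_zero]
          have : (0 : ℝ) ≤ ξ y := Nat.cast_nonneg _
          nlinarith
        · have h' : ξ y = 0 := by omega
          rw [h', Nat.cast_zero, add_zero]
          have : (0 : ℝ) ≤ ξ x := Nat.cast_nonneg _
          nlinarith
      have h6 : 0 ≤ (1 + A) ^ 2 * (ξ x * ξ y) * (H.diam * (weight α ξ * R ξ)) := by positivity
      have h7 : pairEnergy α F ξ x y ≤
          A * (2 * A + ξ x + ξ y) * (H.diam / (a ^ 2 * G.cMin) * E ξ) := by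
        calc _ = (α x + ξ x) * (α y + ξ y) *
              (weight α ξ * (F (ξ + Pi.single x 1) - F (ξ + Pi.single y 1)) ^ 2) := by
              unfold pairEnergy; ring
          _ ≤ _ := mul_le_mul h3 hdg (by positivity) (by positivity)
      linarith
  have hξ : ∀ ξ ∈ configs V k, ∑ x, ∑ y, pairEnergy α F ξ x y ≤
      (1 + A) ^ 2 * (k : ℝ) ^ 2 * (H.diam * (weight α ξ * R ξ)) +
      A * (2 * n ^ 2 * A + 2 * n * k) * (H.diam / (a ^ 2 * G.cMin) * E ξ) := by
    intro ξ hξ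
    have hk : ∑ x, (ξ x : ℝ) = k := by exact_mod_cast mem_configs.1 hξ
    refine (Finset.sum_le_sum fun x _ => Finset.sum_le_sum fun y _ => hone ξ x y).trans_eq ?_
    simp_rw [Finset.sum_add_distrib, ← Finset.sum_mul, ← Finset.mul_sum, ← Finset.sum_mul,
      Finset.sum_add_distrib, ← Finset.mul_sum, hk]
    simp only [Finset.sum_const, Finset.card_univ, nsmul_eq_mul, ← hn, ← Finset.mul_sum, hk]
    ring
  have hsumR : ∑ ξ ∈ configs V k, weight α ξ * R ξ ≤
      n ^ 2 * (8 * (A / (a ^ 2 * G.cMin)) * ∑ ξ ∈ configs V k, E ξ) := by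
    have hpair : ∀ p : V × V, ∑ ξ ∈ configs V k with good ξ p.1 p.2, weight α ξ *
        ((F (ξ + Pi.single p.1 1) - F (ξ + Pi.single p.2 1)) ^ 2 / H.dist p.1 p.2) ≤
        8 * (A / (a ^ 2 * G.cMin)) * ∑ ξ ∈ configs V k, E ξ := by
      rintro ⟨u, v⟩
      have hEs : 0 ≤ ∑ ξ ∈ configs V k, E ξ := Finset.sum_nonneg fun ξ _ => hE0 ξ
      by_cases huv : u = v
      · subst huv
        simp only [sub_self, zero_pow two_ne_zero, zero_div, mul_zero, Finset.sum_const_zero]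
        positivity
      have h := cMin_mul_sum_good_le G ha hα hA F (k := k) (hG.pos_dist_of_ne huv).ne'
        (hz0 u v) (hzd u v) (hadj u v) (fun s hs => (hdist u v s hs).1)
        (S := (configs V k).filter fun ξ => good ξ u v) (Finset.filter_subset _ _)
        (fun ξ h => (Finset.mem_filter.1 h).2.2.1) (fun ξ h => (Finset.mem_filter.1 h).2.2.2.1)
        (fun ξ h => (Finset.mem_filter.1 h).2.2.2.2) hc.le
      have hswap : ∑ x, ∑ y, G.c x y * ∑ ζ ∈ configs V k, pairEnergy α F ζ x y
          = ∑ ξ ∈ configs V k, E ξ := by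
        rw [hE, Finset.sum_comm]
        simp_rw [Finset.sum_comm (s := configs V k), Finset.mul_sum]
        rw [Finset.sum_comm]
      rw [hswap] at h
      have h' := (le_div_iff₀' hc).2 h
      refine h'.trans_eq ?_
      field_simp
    have hexch : ∑ ξ ∈ configs V k, weight α ξ * R ξ = ∑ p : V × V,
        ∑ ξ ∈ configs V k with good ξ p.1 p.2, weight α ξ *
        ((F (ξ + Pi.single p.1 1) - F (ξ + Pi.single p.2 1)) ^ 2 / H.dist p.1 p.2) := by
      simp only [hR, Finset.mul_sum]
      refine Finset.sum_comm' fun ξ p => ?_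
      simp
    rw [hexch]
    refine (Finset.sum_le_sum fun p _ => hpair p).trans_eq ?_
    rw [Finset.sum_const, Finset.card_univ, Fintype.card_prod, nsmul_eq_mul, hn]
    push_cast
    ring
  refine (Finset.sum_le_sum hξ).trans ?_
  simp_rw [Finset.sum_add_distrib, ← Finset.mul_sum]
  calc _ ≤ (1 + A) ^ 2 * (k : ℝ) ^ 2 * (H.diam *
          (n ^ 2 * (8 * (A / (a ^ 2 * G.cMin)) * ∑ ξ ∈ configs V k, E ξ))) +
        A * (2 * n ^ 2 * A + 2 * n * k) *
          (H.diam / (a ^ 2 * G.cMin) * ∑ ξ ∈ configs V k, E ξ) := by gcongr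
    _ = _ := by ring

end Piles

end SIP


/-! ### The explicit constant. -/

theorem theorem3p2 {V : Type*} [Fintype V] [DecidableEq V] [Nontrivial V]
    (G : SIP.WGraph V) (hG : G.toSimpleGraph.Connected)
    (α : V → ℝ) (hα : ∀ x, 0 < α x)
    (k : ℕ) (hk : 2 ≤ k) (f : SIP.Config V k → ℝ) :
    SIP.dirichletForm (SIP.completeWGraph V) α k f ≤
      21 * (k : ℝ) * (SIP.alphaMax α + (k : ℝ) - 1) * (Fintype.card V : ℝ) ^ 2
          * (G.toSimpleGraph.diam : ℝ) * (6 : ℝ) ^ (SIP.alphaMax α)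
        / (SIP.alphaMin α * SIP.alphaRatio α * G.cMin)
        * SIP.dirichletForm G α k f := by
  obtain ⟨K, rfl⟩ : ∃ K, k = K + 1 := ⟨k - 1, by omega⟩
  set a := SIP.alphaMin α with ha
  set A := SIP.alphaMax α with hA
  set n : ℝ := (Fintype.card V : ℝ) with hn
  have haα : ∀ x, a ≤ α x := fun x => Finset.inf'_le _ (Finset.mem_univ x)
  have hAα : ∀ x, α x ≤ A := fun x => Finset.le_sup' _ (Finset.mem_univ x)
  have ha0 : 0 < a := (Finset.lt_inf'_iff _).2 fun x _ => hα x
  have hA0 : 0 < A := (hα (Classical.arbitrary V)).trans_le (hAα _)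
  have hc := G.cMin_pos hG
  have hn1 : 1 ≤ n := Nat.one_le_cast.2 Fintype.card_pos
  have hS : 0 < ∑ x, α x := Finset.sum_pos (fun x _ => hα x) Finset.univ_nonempty
  have hZ : 0 < SIP.partitionFn α (K + 1) := by
    have h1 := Real.Gamma_pos_of_pos hS
    have h2 : 0 < Real.Gamma ((∑ x, α x) + (K + 1 : ℕ)) := Real.Gamma_pos_of_pos (by positivity)
    unfold SIP.partitionFn
    positivity
  set P := (6 : ℝ) ^ A with hP
  -- `(1 + A) ^ 2 ≤ 2 * (1 + A + A ^ 2 / 2) ≤ 2 * exp A`, and `exp 1 ≤ 6`.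
  have hP1 : (1 + A) ^ 2 ≤ 2 * P := by
    have h1 := Real.quadratic_le_exp_of_nonneg hA0.le
    have h2 : Real.exp A ≤ P := by
      rw [hP, ← Real.exp_one_rpow]
      exact Real.rpow_le_rpow (Real.exp_pos 1).le (by linarith [Real.exp_one_lt_d9]) hA0.le
    nlinarith
  have hP2 : 1 ≤ P := Real.one_le_rpow (by norm_num) hA0.le
  have hmain := SIP.sum_pairEnergy_le G hG ha0 haα hAα (SIP.extend f) K
  set E := ∑ ξ ∈ SIP.configs V K, ∑ x, ∑ y, G.c x y * SIP.pairEnergy α (SIP.extend f) ξ x y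
    with hE
  have hnn : ∀ ξ x y, 0 ≤ SIP.pairEnergy α (SIP.extend f) ξ x y := fun ξ x y =>
    SIP.pairEnergy_nonneg hα _ _ _ _
  have hE0 : 0 ≤ E := Finset.sum_nonneg fun ξ _ => Finset.sum_nonneg fun u _ =>
    Finset.sum_nonneg fun v _ => mul_nonneg (G.nonneg _ _) (hnn _ _ _)
  have hcomplete : ∑ ξ ∈ SIP.configs V K, ∑ x, ∑ y,
      (SIP.completeWGraph V).c x y * SIP.pairEnergy α (SIP.extend f) ξ x y ≤
      ∑ ξ ∈ SIP.configs V K, ∑ x, ∑ y, SIP.pairEnergy α (SIP.extend f) ξ x y := by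
    refine Finset.sum_le_sum fun ξ _ => Finset.sum_le_sum fun x _ => Finset.sum_le_sum fun y _ =>
      mul_le_of_le_one_left (hnn _ _ _) ?_
    simp only [SIP.completeWGraph]
    split_ifs <;> norm_num
  -- The occupied pairs contribute `16` and the remaining ones `2`, within the allowed `21`.
  have hconst : 8 * n ^ 2 * (1 + A) ^ 2 * (K : ℝ) ^ 2 + 2 * n ^ 2 * A + 2 * n * K ≤
      21 * (K + 1) * (A + K) * n ^ 2 * P := by
    have hK0 : (0 : ℝ) ≤ K := Nat.cast_nonneg K
    have h1 : 8 * n ^ 2 * (1 + A) ^ 2 * (K : ℝ) ^ 2 ≤ 16 * n ^ 2 * P * ((K + 1) * (A + K)) := by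
      calc _ = 8 * n ^ 2 * (1 + A) ^ 2 * (K * K) := by ring
        _ ≤ 8 * n ^ 2 * (2 * P) * ((K + 1) * (A + K)) := by
          gcongr <;> linarith
        _ = _ := by ring
    have h2 : 2 * n ^ 2 * A + 2 * n * K ≤ 2 * n ^ 2 * (A + K) := by
      nlinarith [mul_nonneg (mul_nonneg (by linarith : 0 ≤ n) (sub_nonneg.2 hn1)) hK0]
    have h3 : 2 * n ^ 2 * (A + K) ≤ 2 * n ^ 2 * P * ((K + 1) * (A + K)) := by
      calc _ = 2 * n ^ 2 * 1 * (1 * (A + K)) := by ring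
        _ ≤ _ := by gcongr; linarith
    have h4 : 0 ≤ n ^ 2 * P * ((K + 1) * (A + K)) := by positivity
    linarith
  rw [SIP.dirichletForm_eq _ hα, SIP.dirichletForm_eq _ hα, ← hE, mul_left_comm]
  refine mul_le_mul_of_nonneg_left (hcomplete.trans (hmain.trans ?_)) (by positivity)
  refine mul_le_mul_of_nonneg_right ?_ hE0
  calc _ ≤ G.toSimpleGraph.diam * A / (a ^ 2 * G.cMin) * (21 * (K + 1) * (A + K) * n ^ 2 * P) := by
        gcongr
    _ = _ := by
        rw [SIP.alphaRatio, ← ha, ← hA]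
        push_cast
        field_simp
        ring
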